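/- Let $(d_k)_{k\ge 1}$, $(\hat d_k)_{k\ge 1}$, $(\beta_k)_{k\ge 1}$ be sequences of positive numbers with $\sum_{k} d_k<\infty$, and let $C_1,C_2>0$ and $\alpha\ge 3$ be real numbers such that, for all $k\ge 1$, $$\hat d_k\le C_1\min\{d_k,d_{k+1}\},\qquad \beta_k\le C_2(\hat d_k)^{\alpha},\qquad C_2\le \frac1{C_1}\Bigl(\max_{j\ge 1}\hat d_j\Bigr)^{1-\alpha}.$$ Put $x_k:=\sum_{j=1}^{k}(d_j+\hat d_j)-\hat d_k$ and define the rooms and passages $$R_k:=(x_k-d_k,x_k)\times\Bigl(-\tfrac{d_k}2,\tfrac{d_k}2\Bigr),\qquad P_k:=[x_k,x_k+\hat d_k]\times\Bigl(-\tfrac{\beta_k}2,\tfrac{\beta_k}2\Bigr),\qquad \Omega:=\bigcup_{k\ge 1}(R_k\cup P_k)\subset\mathbb R^2 .$$ Then: 1. $\Omega$ is open, connected and bounded. 2. The embedding $H^1(\Omega)\hookrightarrow L^2(\Omega)$ is not compact. Here $L^2(\Omega)$ is the space of complex square integrable functions, and $H^1(\Omega)$ is the space of $u\in L^2(\Omega)$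 with first order weak derivatives in $L^2(\Omega)$, normed by $\|u\|_{H^1}^2=\|u\|_{L^2}^2+\|\nabla u\|_{L^2}^2$. 3. Let $A_\Omega$ be the Neumann Laplacian on $\Omega$, that is, the operator in $L^2(\Omega)$ associated with the form $\mathfrak a_\Omega[u,v]=\int_\Omega\nabla u\cdot\overline{\nabla v}\,dx$ on $H^1(\Omega)$: its domain consists of all $u\in H^1(\Omega)$ for which there is $f\in L^2(\Omega)$ with $(f,v)_{L^2(\Omega)}=\mathfrak a_\Omega[u,v]$ for all $v\in H^1(\Omega)$, and then $A_\Omega u=f$. The operator $A_\Omega$ is self-adjoint, and its essential spectrum $\sigma_{\mathrm{ess}}(A_\Omega)$ is not empty. Here $\sigma_{\mathrm{ess}}(A_\Omega)$ is the set of all points of the spectrum of $A_\Omega$ that are not isolated points of the spectrum which are eigenvalues with finite-dimensional eigenspace. -/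

import Mathlib

open MeasureTheory
open scoped ContDiff ENNReal

namespace RoomsPassages

/-! ### First order Sobolev space of a planar set -/

/-- The complex Hilbert space `L²(Ω)`, with respect to Lebesgue measure on `Ω ⊆ ℝ²`. -/
abbrev L2 (Ω : Set (ℝ × ℝ)) : Type := Lp ℂ 2 (volume.restrict Ω)

/-- `φ` is a (real valued) test function on `Ω`, that is, `φ ∈ C_c^∞(Ω)`. -/
structure IsTestFunction (Ω : Set (ℝ × ℝ)) (φ : ℝ × ℝ → ℝ) : Prop where
  contDiff : ContDiff ℝ ∞ φ
  hasCompactSupport : HasCompactSupport φ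
  tsupport_subset : tsupport φ ⊆ Ω

/-- `g` is the weak derivative of `u` on `Ω` in the direction `e`. -/
def HasWeakPartial (Ω : Set (ℝ × ℝ)) (e : ℝ × ℝ) (u g : L2 Ω) : Prop :=
  ∀ φ : ℝ × ℝ → ℝ, IsTestFunction Ω φ →
    ∫ z in Ω, (fderiv ℝ φ z e) • u z = - ∫ z in Ω, φ z • g z

section aux

variable {Ω : Set (ℝ × ℝ)} {φ : ℝ × ℝ → ℝ}

theorem IsTestFunction.continuous_fderiv_apply (hφ : IsTestFunction Ω φ) (e : ℝ × ℝ) :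
    Continuous fun z => fderiv ℝ φ z e :=
  (hφ.contDiff.continuous_fderiv (by simp)).clm_apply continuous_const

theorem IsTestFunction.hasCompactSupport_fderiv_apply (hφ : IsTestFunction Ω φ) (e : ℝ × ℝ) :
    HasCompactSupport fun z => fderiv ℝ φ z e :=
  hφ.hasCompactSupport.fderiv_apply ℝ e

theorem integrable_smul_L2 {ψ : ℝ × ℝ → ℝ} (hc : Continuous ψ) (hs : HasCompactSupport ψ)
    (u : L2 Ω) : Integrable (fun z => ψ z • u z) (volume.restrict Ω) := by
  have h1 : MemLp ψ 2 (volume.restrict Ω) := hc.memLp_of_hasCompactSupport hs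
  exact memLp_one_iff_integrable.mp ((Lp.memLp u).smul h1)

theorem HasWeakPartial.zero (e : ℝ × ℝ) : HasWeakPartial Ω e 0 0 := by
  intro φ _
  have h0 := Lp.coeFn_zero ℂ 2 (volume.restrict Ω)
  rw [integral_congr_ae (g := fun _ => (0 : ℂ)) (by filter_upwards [h0] with z hz; rw [hz]; simp),
    integral_congr_ae (f := fun z => φ z • (0 : L2 Ω) z) (g := fun _ => (0 : ℂ))
      (by filter_upwards [h0] with z hz; rw [hz]; simp)]
  simp

theorem HasWeakPartial.add {e : ℝ × ℝ} {u g v h : L2 Ω} (hu : HasWeakPartial Ω e u g)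
    (hv : HasWeakPartial Ω e v h) : HasWeakPartial Ω e (u + v) (g + h) := by
  intro φ hφ
  have hc := hφ.continuous_fderiv_apply e
  have hs := hφ.hasCompactSupport_fderiv_apply e
  rw [integral_congr_ae (g := fun z => (fderiv ℝ φ z e) • u z + (fderiv ℝ φ z e) • v z)
      (by filter_upwards [Lp.coeFn_add u v] with z hz; rw [hz, Pi.add_apply, smul_add]),
    integral_congr_ae (f := fun z => φ z • (g + h) z) (g := fun z => φ z • g z + φ z • h z)
      (by filter_upwards [Lp.coeFn_add g h] with z hz; rw [hz, Pi.add_apply, smul_add]),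
    integral_add (integrable_smul_L2 hc hs u) (integrable_smul_L2 hc hs v),
    integral_add (integrable_smul_L2 hφ.contDiff.continuous hφ.hasCompactSupport g)
      (integrable_smul_L2 hφ.contDiff.continuous hφ.hasCompactSupport h), hu φ hφ, hv φ hφ]
  ring

theorem HasWeakPartial.smul {e : ℝ × ℝ} {u g : L2 Ω} (c : ℂ) (hu : HasWeakPartial Ω e u g) :
    HasWeakPartial Ω e (c • u) (c • g) := by
  intro φ hφ
  rw [integral_congr_ae (g := fun z => c • ((fderiv ℝ φ z e) • u z))
      (by filter_upwards [Lp.coeFn_smul c u] with z hz; rw [hz, Pi.smul_apply, smul_comm]),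
    integral_congr_ae (f := fun z => φ z • (c • g) z) (g := fun z => c • (φ z • g z))
      (by filter_upwards [Lp.coeFn_smul c g] with z hz; rw [hz, Pi.smul_apply, smul_comm]),
    integral_smul, integral_smul, hu φ hφ, smul_neg]

end aux

/-- The Sobolev space `H¹(Ω)`. A function `u ∈ H¹(Ω)` is stored together with its (unique) weak
gradient, as the triple `(u, ∂₁u, ∂₂u)`. The norm inherited from the `ℓ²` product is the usual one,
`‖u‖²_{H¹} = ‖u‖² + ‖∂₁u‖² + ‖∂₂u‖²`. -/
def H1 (Ω : Set (ℝ × ℝ)) : Submodule ℂ (PiLp 2 fun _ : Fin 3 => L2 Ω) where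
  carrier := {U | HasWeakPartial Ω (1, 0) (U 0) (U 1) ∧ HasWeakPartial Ω (0, 1) (U 0) (U 2)}
  zero_mem' := ⟨HasWeakPartial.zero _, HasWeakPartial.zero _⟩
  add_mem' hU hV := ⟨hU.1.add hV.1, hU.2.add hV.2⟩
  smul_mem' c _ hU := ⟨hU.1.smul c, hU.2.smul c⟩

/-- The embedding `H¹(Ω) ↪ L²(Ω)`. -/
noncomputable def embedding (Ω : Set (ℝ × ℝ)) : H1 Ω →L[ℂ] L2 Ω :=
  (PiLp.proj 2 (𝕜 := ℂ) (fun _ : Fin 3 => L2 Ω) 0).comp (H1 Ω).subtypeL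

/-! ### The Neumann Laplacian -/

/-- The form `a[u, v] = ∫_Ω ∇u · conj ∇v` on `H¹(Ω)`. (Mathlib's inner products are conjugate linear
in the first argument.) -/
noncomputable def neumannForm (Ω : Set (ℝ × ℝ)) (U V : H1 Ω) : ℂ :=
  inner ℂ (V.1 1) (U.1 1) + inner ℂ (V.1 2) (U.1 2)

/-- All pairs `(u, f) ∈ L²(Ω) × L²(Ω)` with `u ∈ H¹(Ω)` and `(f, v)_{L²} = a[u, v]` for all
`v ∈ H¹(Ω)`. -/
def neumannGraph (Ω : Set (ℝ × ℝ)) : Submodule ℂ (L2 Ω × L2 Ω) where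
  carrier := {p | ∃ U : H1 Ω, embedding Ω U = p.1 ∧
    ∀ V : H1 Ω, inner ℂ (embedding Ω V) p.2 = neumannForm Ω U V}
  zero_mem' := ⟨0, by simp, fun V => by simp [neumannForm]⟩
  add_mem' := by
    rintro p q ⟨U, hU, hU'⟩ ⟨V, hV, hV'⟩
    refine ⟨U + V, by simp [hU, hV], fun W => ?_⟩
    simp only [Prod.snd_add, inner_add_right, hU', hV', neumannForm, Submodule.coe_add,
      PiLp.add_apply]
    ring
  smul_mem' := by
    rintro c p ⟨U, hU, hU'⟩
    refine ⟨c • U, by simp [hU], fun W => ?_⟩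
    simp only [Prod.smul_snd, inner_smul_right, hU', neumannForm, Submodule.coe_smul,
      PiLp.smul_apply]
    ring

/-- The Neumann Laplacian `A_Ω`, the operator in `L²(Ω)` associated with the form `a`: its domain
consists of all `u ∈ H¹(Ω)` for which there is `f ∈ L²(Ω)` with `(f, v) = a[u, v]` for all
`v ∈ H¹(Ω)`, and then `A_Ω u = f`. -/
noncomputable def neumannLaplacian (Ω : Set (ℝ × ℝ)) : L2 Ω →ₗ.[ℂ] L2 Ω :=
  (neumannGraph Ω).toLinearPMap

section wellDefined

variable {Ω : Set (ℝ × ℝ)}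

theorem locallyIntegrableOn_L2 (f : L2 Ω) : LocallyIntegrableOn (f : ℝ × ℝ → ℂ) Ω
    (volume.restrict Ω) :=
  ((Lp.memLp f).locallyIntegrable (by norm_num)).locallyIntegrableOn Ω

/-- Fundamental lemma of the calculus of variations in `L²(Ω)`. -/
theorem eq_zero_of_forall_testFunction (hΩ : IsOpen Ω) {f : L2 Ω}
    (h : ∀ φ, IsTestFunction Ω φ → ∫ z in Ω, φ z • f z = 0) : f = 0 := by
  have key := hΩ.ae_eq_zero_of_integral_contDiff_smul_eq_zero (locallyIntegrableOn_L2 f)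
    fun φ h1 h2 h3 => h φ ⟨h1, h2, h3⟩
  rw [Lp.eq_zero_iff_ae_eq_zero]
  filter_upwards [key, ae_restrict_mem hΩ.measurableSet] with z hz hzΩ
  exact hz hzΩ

/-- Weak derivatives are unique. -/
theorem HasWeakPartial.unique (hΩ : IsOpen Ω) {e : ℝ × ℝ} {u g h : L2 Ω}
    (hg : HasWeakPartial Ω e u g) (hh : HasWeakPartial Ω e u h) : g = h := by
  have hd : HasWeakPartial Ω e (u + (-1 : ℂ) • u) (g + (-1 : ℂ) • h) := hg.add (hh.smul (-1))
  have hu : u + (-1 : ℂ) • u = 0 := by simp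
  rw [hu] at hd
  have h0 : g + (-1 : ℂ) • h = 0 := by
    refine eq_zero_of_forall_testFunction hΩ fun φ hφ => ?_
    have h1 := hd φ hφ
    rw [integral_congr_ae (g := fun _ => (0 : ℂ))
      (by filter_upwards [Lp.coeFn_zero ℂ 2 (volume.restrict Ω)] with z hz; rw [hz]; simp)] at h1
    simpa using h1.symm
  simpa [← sub_eq_add_neg, sub_eq_zero] using h0

/-- The embedding of `H¹(Ω)` into `L²(Ω)` is injective. -/
theorem embedding_injective (hΩ : IsOpen Ω) : Function.Injective (embedding Ω) := by
  intro U V hUV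
  have h0 : U.1 0 = V.1 0 := hUV
  have h1 : U.1 1 = V.1 1 := HasWeakPartial.unique hΩ U.2.1 (h0 ▸ V.2.1)
  have h2 : U.1 2 = V.1 2 := HasWeakPartial.unique hΩ U.2.2 (h0 ▸ V.2.2)
  ext i : 2
  fin_cases i
  · exact h0
  · exact h1
  · exact h2

theorem memLp_ofReal {ψ : ℝ × ℝ → ℝ} (hc : Continuous ψ) (hs : HasCompactSupport ψ) :
    MemLp (fun z => (ψ z : ℂ)) 2 (volume.restrict Ω) :=
  (Complex.continuous_ofReal.comp hc).memLp_of_hasCompactSupport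
    (hs.comp_left (g := fun x : ℝ => (x : ℂ)) Complex.ofReal_zero)

theorem IsTestFunction.hasWeakPartial {φ : ℝ × ℝ → ℝ} (hφ : IsTestFunction Ω φ) (e : ℝ × ℝ) :
    HasWeakPartial Ω e (memLp_ofReal hφ.contDiff.continuous hφ.hasCompactSupport).toLp
      (memLp_ofReal (hφ.continuous_fderiv_apply e) (hφ.hasCompactSupport_fderiv_apply e)).toLp := by
  intro ψ hψ
  rw [integral_congr_ae (g := fun z => ((fderiv ℝ ψ z e * φ z : ℝ) : ℂ))
      (by filter_upwards [MemLp.coeFn_toLp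
            (memLp_ofReal (Ω := Ω) hφ.contDiff.continuous hφ.hasCompactSupport)] with z hz
          rw [hz]; simp),
    integral_congr_ae (f := fun z => ψ z • _) (g := fun z => ((ψ z * fderiv ℝ φ z e : ℝ) : ℂ))
      (by filter_upwards [MemLp.coeFn_toLp (memLp_ofReal (Ω := Ω) (hφ.continuous_fderiv_apply e)
            (hφ.hasCompactSupport_fderiv_apply e))] with z hz
          rw [hz]; simp),
    integral_complex_ofReal, integral_complex_ofReal, ← Complex.ofReal_neg]
  congr 1
  have hz : ∀ z ∉ Ω, ψ z = 0 := fun z hz =>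
    image_eq_zero_of_notMem_tsupport fun h => hz (hψ.tsupport_subset h)
  have hz' : ∀ z ∉ Ω, φ z = 0 := fun z hz =>
    image_eq_zero_of_notMem_tsupport fun h => hz (hφ.tsupport_subset h)
  rw [setIntegral_eq_integral_of_forall_compl_eq_zero fun z h => by simp [hz' z h],
    setIntegral_eq_integral_of_forall_compl_eq_zero fun z h => by simp [hz z h]]
  have hψd : Differentiable ℝ ψ := hψ.contDiff.differentiable (by simp)
  have hφd : Differentiable ℝ φ := hφ.contDiff.differentiable (by simp)
  have := integral_mul_fderiv_eq_neg_fderiv_mul_of_integrable (μ := volume) (f := ψ) (g := φ)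
    (v := e)
    (((hψ.continuous_fderiv_apply e).mul hφ.contDiff.continuous).integrable_of_hasCompactSupport
      (hψ.hasCompactSupport_fderiv_apply e).mul_right)
    ((hψ.contDiff.continuous.mul (hφ.continuous_fderiv_apply e)).integrable_of_hasCompactSupport
      hψ.hasCompactSupport.mul_right)
    ((hψ.contDiff.continuous.mul hφ.contDiff.continuous).integrable_of_hasCompactSupport
      hψ.hasCompactSupport.mul_right)
    (fun x _ => hψd x) (fun x _ => hφd x)
  rw [this, neg_neg]

/-- For open `Ω` the relation defining the Neumann Laplacian is the graph of an operator, so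
`neumannLaplacian Ω` is the operator described in its definition. -/
theorem neumannLaplacian_graph (hΩ : IsOpen Ω) : (neumannLaplacian Ω).graph = neumannGraph Ω := by
  refine Submodule.toLinearPMap_graph_eq _ ?_
  rintro ⟨u, f⟩ ⟨U, hU, hU'⟩ hu
  obtain rfl : U = 0 := embedding_injective hΩ (by rw [hU, hu, map_zero])
  refine eq_zero_of_forall_testFunction hΩ fun φ hφ => ?_
  let V : H1 Ω := ⟨WithLp.toLp 2
    ![(memLp_ofReal hφ.contDiff.continuous hφ.hasCompactSupport).toLp,
      (memLp_ofReal (hφ.continuous_fderiv_apply (1, 0))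
        (hφ.hasCompactSupport_fderiv_apply (1, 0))).toLp,
      (memLp_ofReal (hφ.continuous_fderiv_apply (0, 1))
        (hφ.hasCompactSupport_fderiv_apply (0, 1))).toLp],
    hφ.hasWeakPartial (1, 0), hφ.hasWeakPartial (0, 1)⟩
  have hV : inner ℂ (embedding Ω V) f = 0 := by simpa [neumannForm] using hU' V
  have hV' : embedding Ω V
      = (memLp_ofReal (Ω := Ω) hφ.contDiff.continuous hφ.hasCompactSupport).toLp := rfl
  rw [hV', L2.inner_def] at hV
  rw [← hV]
  refine integral_congr_ae ?_
  filter_upwards [MemLp.coeFn_toLp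
    (memLp_ofReal (Ω := Ω) hφ.contDiff.continuous hφ.hasCompactSupport)] with z hz
  simp [hz, mul_comm]

end wellDefined

/-! ### Spectrum and essential spectrum of an unbounded operator -/

section Spectrum

variable {H : Type*} [NormedAddCommGroup H] [InnerProductSpace ℂ H]

/-- `A - z`, as a linear map on the domain of `A`. -/
def shift (A : H →ₗ.[ℂ] H) (z : ℂ) : A.domain →ₗ[ℂ] H :=
  A.toFun - z • A.domain.subtype

/-- The spectrum of `A`: all `z` such that `A - z` has no bounded, everywhere defined inverse. -/
def spectrumOp (A : H →ₗ.[ℂ] H) : Set ℂ :=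
  {z | ¬ ∃ R : H →L[ℂ] H, (∀ u : A.domain, R (shift A z u) = u) ∧
    ∀ f : H, ∃ u : A.domain, (u : H) = R f ∧ shift A z u = f}

/-- The discrete spectrum of `A`: the eigenvalues with finite dimensional eigenspace that are
isolated points of the spectrum. -/
def discreteSpectrum (A : H →ₗ.[ℂ] H) : Set ℂ :=
  {z | z ∈ spectrumOp A ∧ (∃ ε > 0, ∀ w ∈ spectrumOp A, dist w z < ε → w = z) ∧
    LinearMap.ker (shift A z) ≠ ⊥ ∧ FiniteDimensional ℂ (LinearMap.ker (shift A z))}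

/-- The essential spectrum of `A`: the complement of the discrete spectrum in the spectrum. -/
def essentialSpectrum (A : H →ₗ.[ℂ] H) : Set ℂ :=
  spectrumOp A \ discreteSpectrum A

end Spectrum

/-! ### The rooms-and-passages domain

The sequences are indexed from `0` here, so that `d k`, `dh k`, `β k` are the parameters of the
room and of the passage with number `k + 1`. -/

/-- The abscissa of the right end of the room with index `k`:
the sum of `d j + dh j` over `j ≤ k`, minus `dh k`. -/
noncomputable def abscissa (d dh : ℕ → ℝ) (k : ℕ) : ℝ :=
  ∑ j ∈ Finset.range (k + 1), (d j + dh j) - dh k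

/-- The room with index `k`, an open square of side `d k`. -/
noncomputable def room (d dh : ℕ → ℝ) (k : ℕ) : Set (ℝ × ℝ) :=
  Set.Ioo (abscissa d dh k - d k) (abscissa d dh k) ×ˢ Set.Ioo (-(d k / 2)) (d k / 2)

/-- The passage with index `k`, of length `dh k` and width `β k`, between the rooms `k`, `k + 1`. -/
noncomputable def passage (d dh β : ℕ → ℝ) (k : ℕ) : Set (ℝ × ℝ) :=
  Set.Icc (abscissa d dh k) (abscissa d dh k + dh k) ×ˢ Set.Ioo (-(β k / 2)) (β k / 2)

/-- The rooms-and-passages domain. -/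
noncomputable def domain (d dh β : ℕ → ℝ) : Set (ℝ × ℝ) :=
  ⋃ k, room d dh k ∪ passage d dh β k

end RoomsPassages

/-!
Write `J` for the embedding of `H¹(Ω)` into `L²(Ω)`. Then `(A_Ω + 1)⁻¹ = J J*` is bounded and
self-adjoint, so `A_Ω` is self-adjoint, and `l ↦ l⁻¹ - 1` carries the nonzero spectrum of `J J*`
into the spectrum of `A_Ω`. If the essential spectrum of `A_Ω` were empty, the nonzero
spectrum of `J J*` would consist of isolated eigenvalues with finite dimensional eigenspaces, so
`J J*` would be compact by the functional calculus, and with it `J`.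

But `J` is not compact. Take a function of the abscissa that equals `1` on one room and descends to
`0` across the two adjacent passages. Its `L²` norm squared is at least `d²`, and its energy is of
the order of `β / dh` for these passages, which is `O(d²)` because `β = O(dh ^ 3)` and `dh = O(d)`.
The functions belonging to every other room have disjoint supports, hence are orthogonal in `L²`;
normalized there, they are bounded in `H¹` and have no subsequence that converges in `L²`.
-/

namespace RoomsPassages

section Compact

variable {𝕜 E F : Type*} [RCLike 𝕜] [NormedAddCommGroup E] [NormedAddCommGroup F]

theorem isCompactOperator_of_forall_mem [NormedSpace 𝕜 E] [NormedSpace 𝕜 F] {T : E →L[𝕜] F}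
    {V : Submodule 𝕜 F} [FiniteDimensional 𝕜 V] (h : ∀ x, T x ∈ V) :
    IsCompactOperator T :=
  (isCompactOperator_of_locallyCompactSpace_dom (T.codRestrict V h)).clm_comp V.subtypeL

section NormedDomain

variable [NormedSpace 𝕜 E] [InnerProductSpace 𝕜 F]

theorem not_isCompactOperator_of_orthonormal {S : E →L[𝕜] F} {x : ℕ → E} {C : ℝ}
    (hx : ∀ k, ‖x k‖ ≤ C) (hS : Orthonormal 𝕜 fun k => S (x k)) : ¬ IsCompactOperator S := by
  intro hcomp
  have hK := hcomp.isCompact_closure_image_closedBall (f := (S : E →ₗ[𝕜] F)) C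
  obtain ⟨y, -, φ, hφ, hy⟩ := hK.tendsto_subseq (x := fun k => S (x k)) fun k =>
    subset_closure ⟨x k, by simpa using hx k, rfl⟩
  have hnear : ∀ᶠ k in Filter.atTop, dist (S (x (φ k))) y < 1 / 2 :=
    hy.eventually (Metric.ball_mem_nhds y (by norm_num))
  obtain ⟨N, hN⟩ := Filter.eventually_atTop.1 hnear
  have hclose : dist (S (x (φ N))) (S (x (φ (N + 1)))) < 1 :=
    (dist_triangle_right _ _ y).trans_lt (by linarith [hN N le_rfl, hN (N + 1) N.le_succ])
  have hpyth : ‖S (x (φ N)) - S (x (φ (N + 1)))‖ ^ 2 = 2 := by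
    rw [@norm_sub_sq 𝕜, hS.1, hS.1, hS.2 (hφ N.lt_succ_self).ne, map_zero]
    norm_num
  rw [dist_eq_norm] at hclose
  nlinarith [norm_nonneg (S (x (φ N)) - S (x (φ (N + 1))))]

theorem not_isCompactOperator_of_pairwise_orthogonal {S : E →L[𝕜] F} {x : ℕ → E} {C : ℝ}
    (hx : ∀ k, ‖x k‖ ≤ C * ‖S (x k)‖) (hne : ∀ k, S (x k) ≠ 0)
    (horth : Pairwise fun j k => inner 𝕜 (S (x j)) (S (x k)) = 0) : ¬ IsCompactOperator S := by
  have hpos : ∀ k, 0 < ‖S (x k)‖ := fun k => norm_pos_iff.2 (hne k)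
  refine not_isCompactOperator_of_orthonormal
    (x := fun k => ((‖S (x k)‖⁻¹ : ℝ) : 𝕜) • x k) (C := C) (fun k => ?_) ⟨fun k => ?_, ?_⟩
  · rw [norm_smul, RCLike.norm_ofReal, abs_inv, abs_norm, inv_mul_le_iff₀ (hpos k), mul_comm]
    exact hx k
  · beta_reduce
    rw [map_smul, norm_smul, RCLike.norm_ofReal, abs_inv, abs_norm, inv_mul_cancel₀ (hpos k).ne']
  · intro j k hjk
    simp only [map_smul, inner_smul_left, inner_smul_right, horth hjk, mul_zero]

end NormedDomain

section Adjoint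

variable [InnerProductSpace 𝕜 E] [InnerProductSpace 𝕜 F] [CompleteSpace E] [CompleteSpace F]

open ContinuousLinearMap

theorem norm_map_sq_le_norm_mul_norm_adjoint_comp
    (S : E →L[𝕜] F) (x : E) : ‖S x‖ ^ 2 ≤ ‖x‖ * ‖(adjoint S ∘L S) x‖ := by
  rw [S.apply_norm_sq_eq_inner_adjoint_right]
  exact re_inner_le_norm x _

theorem isCompactOperator_of_adjoint_comp {S : E →L[𝕜] F}
    (hS : IsCompactOperator (adjoint S ∘L S)) : IsCompactOperator S := by
  suffices h : TotallyBounded (S '' Metric.closedBall 0 1) from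
    (isCompactOperator_iff_isCompact_closure_image_closedBall (S : E →ₗ[𝕜] F) one_pos).2
      (h.closure.isCompact_of_isClosed isClosed_closure)
  have hbdd : TotallyBounded ((adjoint S ∘L S) '' Metric.closedBall 0 1) :=
    (hS.isCompact_closure_image_closedBall (f := ((adjoint S ∘L S : E →L[𝕜] E) : E →ₗ[𝕜] E))
      1).totallyBounded.subset subset_closure
  refine Metric.totallyBounded_iff.2 fun ε hε => ?_
  obtain ⟨t, htball, htfin, hcover⟩ := Set.exists_subset_image_finite_and.1
    (hbdd.exists_subset (Metric.dist_mem_uniformity (half_pos (sq_pos_of_pos hε))))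
  refine ⟨S '' t, htfin.image S, ?_⟩
  rintro - ⟨x, hx, rfl⟩
  obtain ⟨-, ⟨y, hy, rfl⟩, hxy⟩ := Set.mem_iUnion₂.1 (hcover ⟨x, hx, rfl⟩)
  refine Set.mem_iUnion₂.2 ⟨S y, ⟨y, hy, rfl⟩, ?_⟩
  have hdist : ‖x - y‖ ≤ 2 := by
    have hx' := mem_closedBall_zero_iff.1 hx
    have hy' := mem_closedBall_zero_iff.1 (htball hy)
    linarith [norm_sub_le x y]
  have hxy' : ‖(adjoint S ∘L S) (x - y)‖ < ε ^ 2 / 2 := by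
    rw [map_sub, ← dist_eq_norm]
    exact hxy
  rw [Metric.mem_ball, dist_eq_norm, ← map_sub]
  refine lt_of_pow_lt_pow_left₀ 2 hε.le ?_
  calc ‖S (x - y)‖ ^ 2 ≤ ‖x - y‖ * ‖(adjoint S ∘L S) (x - y)‖ :=
        norm_map_sq_le_norm_mul_norm_adjoint_comp S _
    _ ≤ 2 * ‖(adjoint S ∘L S) (x - y)‖ := by gcongr
    _ < ε ^ 2 := by linarith

theorem isCompactOperator_of_comp_adjoint {S : E →L[𝕜] F}
    (hS : IsCompactOperator (S ∘L adjoint S)) : IsCompactOperator S := by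
  have hadj : IsCompactOperator (adjoint S) :=
    isCompactOperator_of_adjoint_comp (by rwa [adjoint_adjoint])
  exact isCompactOperator_of_adjoint_comp (hadj.comp_clm S)

end Adjoint

end Compact

section NormalOperators

theorem finite_inter_setOf_le_norm {E : Type*} [NormedAddCommGroup E] {K : Set E}
    (hK : IsCompact K) (hdisc : IsDiscrete (K \ {0})) {ε : ℝ} (hε : 0 < ε) :
    (K ∩ {l | ε ≤ ‖l‖}).Finite := by
  refine (hK.inter_right (isClosed_le continuous_const continuous_norm)).finite (hdisc.mono ?_)
  rintro l ⟨hl, hεl⟩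
  exact ⟨hl, norm_pos_iff.1 (hε.trans_le hεl)⟩

theorem continuousOn_of_eqOn_zero_ball {E F : Type*} [NormedAddCommGroup E] [TopologicalSpace F]
    [Zero F] {K : Set E} (hdisc : IsDiscrete (K \ {0})) {ε : ℝ} (hε : 0 < ε) {f : E → F}
    (hf : ∀ l, ‖l‖ < ε → f l = 0) : ContinuousOn f K := by
  intro l hl
  by_cases hl0 : l = 0
  · have hzero : f =ᶠ[nhds l] fun _ => 0 := by
      filter_upwards [Metric.ball_mem_nhds l hε] with m hm using hf m (by simpa [hl0] using hm)
    exact hzero.continuousAt.continuousWithinAt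
  · have hpure : ContinuousWithinAt f (K \ {0}) l := by
      rw [ContinuousWithinAt, isDiscrete_iff_nhdsWithin.1 hdisc l ⟨hl, hl0⟩]
      exact tendsto_pure_nhds f l
    exact hpure.mono_of_mem_nhdsWithin
      (inter_mem_nhdsWithin K (isOpen_compl_singleton.mem_nhds hl0))

variable {H : Type*} [NormedAddCommGroup H] [InnerProductSpace ℂ H]

variable [CompleteSpace H] {T : H →L[ℂ] H}

theorem cfc_single_apply_mem_ker [IsStarNormal T] {l c : ℂ}
    (hcont : ContinuousOn (Pi.single l c : ℂ → ℂ) (spectrum ℂ T)) (x : H) :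
    cfc (Pi.single l c : ℂ → ℂ) T x ∈ (T - l • (1 : H →L[ℂ] H)).ker := by
  have hprod : (T - l • 1) * (cfc (Pi.single l c : ℂ → ℂ) T : H →L[ℂ] H) = 0 := by
    calc (T - l • 1) * cfc (Pi.single l c : ℂ → ℂ) T
        = cfc (fun m => m - l) T * cfc (Pi.single l c : ℂ → ℂ) T := by
          rw [cfc_sub (fun m => m) (fun _ => l) T, cfc_id' ℂ T, cfc_const l T,
            Algebra.algebraMap_eq_smul_one]
      _ = cfc (fun m => (m - l) * (Pi.single l c : ℂ → ℂ) m) T := (cfc_mul _ _ T).symm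
      _ = 0 := by
          rw [← cfc_const_zero ℂ T]
          congr 1 with m
          by_cases hm : m = l <;> simp [hm]
  exact DFunLike.congr_fun hprod x

theorem isCompactOperator_cfc [IsStarNormal T] (hdisc : IsDiscrete (spectrum ℂ T \ {0}))
    (hfin : ∀ l ∈ spectrum ℂ T, l ≠ 0 → FiniteDimensional ℂ (T - l • (1 : H →L[ℂ] H)).ker)
    {ε : ℝ} (hε : 0 < ε) {f : ℂ → ℂ} (hf : ∀ l, ‖l‖ < ε → f l = 0) :
    IsCompactOperator (cfc f T : H →L[ℂ] H) := by
  have hSfin := finite_inter_setOf_le_norm (spectrum.isCompact T) hdisc hε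
  have hcont : ∀ l ∈ hSfin.toFinset, ContinuousOn (Pi.single l (f l) : ℂ → ℂ) (spectrum ℂ T) := by
    intro l hl
    refine continuousOn_of_eqOn_zero_ball hdisc hε fun m hm => Pi.single_eq_of_ne ?_ _
    rintro rfl
    exact hm.not_ge (hSfin.mem_toFinset.1 hl).2
  have hsum : cfc f T = ∑ l ∈ hSfin.toFinset, cfc (Pi.single l (f l) : ℂ → ℂ) T := by
    rw [← cfc_sum _ T _ hcont]
    refine cfc_congr fun m hm => ?_
    simp only [Finset.sum_apply, Finset.sum_pi_single]
    split_ifs with hεm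
    · rfl
    · exact hf m (not_le.1 fun hle => hεm (hSfin.mem_toFinset.2 ⟨hm, hle⟩))
  rw [hsum]
  refine Finset.sum_induction _ (fun F : H →L[ℂ] H => IsCompactOperator F)
    (fun F G hF hG => hF.add hG) isCompactOperator_zero fun l hl => ?_
  obtain ⟨hlT, hεl⟩ := hSfin.mem_toFinset.1 hl
  have := hfin l hlT (norm_pos_iff.1 (hε.trans_le hεl))
  exact isCompactOperator_of_forall_mem (cfc_single_apply_mem_ker (hcont l hl))

theorem isCompactOperator_of_isDiscrete_spectrum [IsStarNormal T]
    (hdisc : IsDiscrete (spectrum ℂ T \ {0}))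
    (hfin : ∀ l ∈ spectrum ℂ T, l ≠ 0 → FiniteDimensional ℂ (T - l • (1 : H →L[ℂ] H)).ker) :
    IsCompactOperator T := by
  refine isClosed_setOfPred_isCompactOperator.closure_subset (a := T)
    (Metric.mem_closure_iff.2 fun ε hε => ?_)
  have hε2 := half_pos hε
  let f : ℂ → ℂ := fun l => if ‖l‖ < ε / 2 then 0 else l
  have hf : ∀ l, ‖l‖ < ε / 2 → f l = 0 := fun l hl => if_pos hl
  refine ⟨cfc f T, isCompactOperator_cfc hdisc hfin hε2 hf, ?_⟩
  calc dist T (cfc f T) = ‖cfc (fun l => l - f l) T‖ := by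
        rw [cfc_sub (fun l => l) f T continuousOn_id (continuousOn_of_eqOn_zero_ball hdisc hε2 hf),
          cfc_id' ℂ T, dist_eq_norm]
    _ ≤ ε / 2 := by
        refine norm_cfc_le hε2.le fun l _ => ?_
        by_cases hl : ‖l‖ < ε / 2
        · simpa [f, hl] using hl.le
        · simpa [f, hl] using hε2.le
    _ < ε := half_lt_self hε

end NormalOperators

section Resolvents

variable {H : Type*} [NormedAddCommGroup H] [InnerProductSpace ℂ H]

/-- `T` is the resolvent `(A - z)⁻¹`, a bounded and everywhere defined inverse of `A - z`. A point
`z` belongs to `spectrumOp A` exactly when there is no such `T`. -/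
def IsResolventAt (A : H →ₗ.[ℂ] H) (z : ℂ) (T : H →L[ℂ] H) : Prop :=
  (∀ u : A.domain, T (shift A z u) = u) ∧
    ∀ f : H, ∃ u : A.domain, (u : H) = T f ∧ shift A z u = f

theorem shift_eq_shift_add_smul (A : H →ₗ.[ℂ] H) (z w : ℂ) (u : A.domain) :
    shift A w u = shift A z u + (z - w) • (u : H) := by
  change A u - w • (u : H) = A u - z • (u : H) + (z - w) • (u : H)
  module

theorem isDiscrete_spectrumOp {A : H →ₗ.[ℂ] H} (hA : essentialSpectrum A = ∅) :
    IsDiscrete (spectrumOp A) := by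
  refine IsDiscrete.of_nhdsWithin fun z hz => Filter.le_pure_iff.2 ?_
  obtain ⟨-, ⟨ε, hε, hiso⟩, -⟩ := Set.sdiff_eq_empty.1 hA hz
  exact Metric.mem_nhdsWithin_iff.2 ⟨ε, hε, fun w hw => hiso w hw.2 hw.1⟩

namespace IsResolventAt

variable {A : H →ₗ.[ℂ] H} {z w : ℂ} {T R : H →L[ℂ] H}

theorem mem_graph_iff (hT : IsResolventAt A z T) {u g : H} :
    (u, g) ∈ A.graph ↔ T (g - z • u) = u := by
  rw [LinearPMap.mem_graph_iff]
  constructor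
  · rintro ⟨v, rfl, rfl⟩
    exact hT.1 v
  · intro hu
    obtain ⟨v, hv, hAv⟩ := hT.2 (g - z • u)
    refine ⟨v, hv.trans hu, ?_⟩
    rw [hu] at hv
    have hAv : A v - z • (v : H) = g - z • u := hAv
    rwa [hv, sub_left_inj] at hAv

theorem of_forall_mem_graph_iff (h : ∀ u g : H, (u, g) ∈ A.graph ↔ T (g - z • u) = u) :
    IsResolventAt A z T := by
  refine ⟨fun u => (h _ _).1 (A.mem_graph u), fun f => ?_⟩
  obtain ⟨u, hu, hAu⟩ := (LinearPMap.mem_graph_iff A).1 ((h (T f) (f + z • T f)).2 (by simp))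
  refine ⟨u, hu, ?_⟩
  change A u - z • (u : H) = f
  rw [hu, hAu, add_sub_cancel_right]

theorem mem_graph (hT : IsResolventAt A z T) (f : H) : (T f, f + z • T f) ∈ A.graph :=
  hT.mem_graph_iff.2 (by rw [add_sub_cancel_right])

theorem injective (hT : IsResolventAt A z T) : Function.Injective T := by
  refine (injective_iff_map_eq_zero T).2 fun f hf => ?_
  obtain ⟨u, hu, rfl⟩ := hT.2 f
  rw [hf, ZeroMemClass.coe_eq_zero] at hu
  rw [hu, map_zero]

theorem dense_domain [CompleteSpace H] [IsStarNormal T] (hT : IsResolventAt A z T) :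
    Dense (A.domain : Set H) := by
  have hrange : T.range ≤ A.domain := by
    rintro - ⟨f, rfl⟩
    exact LinearPMap.mem_domain_of_mem_graph (hT.mem_graph f)
  have hker : T.ker = ⊥ := LinearMap.ker_eq_bot.2 hT.injective
  rw [Submodule.dense_iff_topologicalClosure_eq_top, Submodule.topologicalClosure_eq_top_iff,
    eq_bot_iff, ← hker, ← ContinuousLinearMap.IsStarNormal.orthogonal_range ‹_›]
  exact Submodule.orthogonal_le hrange

theorem isSelfAdjoint [CompleteSpace H] {x : ℝ} (hT : IsResolventAt A x T)
    (hsa : IsSelfAdjoint T) : IsSelfAdjoint A := by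
  have hsymm : ∀ f g, inner ℂ (T f) g = inner ℂ f (T g) := hsa.isSymmetric
  have := hsa.isStarNormal
  rw [LinearPMap.isSelfAdjoint_def]
  refine LinearPMap.eq_of_eq_graph ?_
  rw [LinearPMap.adjoint_graph_eq_graph_adjoint hT.dense_domain]
  ext ⟨u, g⟩
  rw [Submodule.mem_adjoint_iff, hT.mem_graph_iff]
  constructor
  · intro hu
    refine ext_inner_left ℂ fun f => ?_
    have hf := hu _ _ (hT.mem_graph f)
    simp only [inner_add_left, inner_smul_left, Complex.conj_ofReal, hsymm] at hf
    rw [map_sub, map_smul, inner_sub_right, inner_smul_right]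
    linear_combination -hf
  · intro hu a b hab
    have hf := hsymm (b - (x : ℂ) • a) (g - (x : ℂ) • u)
    rw [hT.mem_graph_iff.1 hab, hu] at hf
    simp only [inner_sub_left, inner_sub_right, inner_smul_left, inner_smul_right,
      Complex.conj_ofReal] at hf
    linear_combination -hf

theorem sub_eq_smul_mul (hT : IsResolventAt A z T) (hR : IsResolventAt A w R) :
    R - T = (w - z) • (R * T) := by
  ext f
  obtain ⟨u, hu, rfl⟩ := hT.2 f
  have hshift := congrArg R (shift_eq_shift_add_smul A z w u)
  rw [hR.1, map_add, map_smul] at hshift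
  change R (shift A z u) - T (shift A z u) = (w - z) • R (T (shift A z u))
  rw [← hu]
  linear_combination (norm := module) (-1 : ℂ) • hshift

/-- If `R = (A - z - l⁻¹)⁻¹` existed, then the resolvent identity would make `l⁻¹ • (1 + l⁻¹ • R)`
an inverse of `l - T`. -/
theorem add_inv_mem_spectrumOp (hT : IsResolventAt A z T) {l : ℂ} (hl : l ≠ 0)
    (hlT : l ∈ spectrum ℂ T) : z + l⁻¹ ∈ spectrumOp A := by
  rintro ⟨R, hR : IsResolventAt A (z + l⁻¹) R⟩
  have hRT := hT.sub_eq_smul_mul hR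
  have hTR := hR.sub_eq_smul_mul hT
  rw [add_sub_cancel_left] at hRT
  rw [sub_add_cancel_left] at hTR
  have hleft : (1 - l⁻¹ • T) * (1 + l⁻¹ • R) = 1 := by
    simp only [sub_mul, mul_add, mul_one, one_mul, smul_mul_smul_comm]
    linear_combination (norm := module) -l⁻¹ • hTR
  have hright : (1 + l⁻¹ • R) * (1 - l⁻¹ • T) = 1 := by
    simp only [add_mul, mul_sub, mul_one, one_mul, smul_mul_smul_comm]
    linear_combination (norm := module) l⁻¹ • hRT
  have hunit : IsUnit (1 - l⁻¹ • T) := isUnit_iff_exists.2 ⟨_, hleft, hright⟩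
  have hfactor : algebraMap ℂ (H →L[ℂ] H) l - T = Units.mk0 l hl • (1 - l⁻¹ • T) := by
    rw [Units.smul_mk0, smul_sub, smul_inv_smul₀ hl, Algebra.algebraMap_eq_smul_one]
  refine hlT (spectrum.mem_resolventSet_iff.2 ?_)
  rw [hfactor]
  exact hunit.smul _

theorem finiteDimensional_ker (hT : IsResolventAt A z T) {l : ℂ} (hl : l ≠ 0)
    [FiniteDimensional ℂ (shift A (z + l⁻¹)).ker] :
    FiniteDimensional ℂ (T - l • (1 : H →L[ℂ] H)).ker := by
  refine Submodule.finiteDimensional_of_le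
    (S₂ := (shift A (z + l⁻¹)).ker.map A.domain.subtype) fun v hv => ?_
  have hTv : T v = l • v := sub_eq_zero.1 hv
  obtain ⟨u, hu, hshift⟩ := hT.2 (l⁻¹ • v)
  rw [map_smul, hTv, inv_smul_smul₀ hl] at hu
  refine ⟨u, ?_, hu⟩
  change shift A (z + l⁻¹) u = 0
  rw [shift_eq_shift_add_smul A z, hshift, hu]
  module

theorem isDiscrete_spectrum (hT : IsResolventAt A z T) (hA : IsDiscrete (spectrumOp A)) :
    IsDiscrete (spectrum ℂ T \ {0}) := by
  have hz : z ∉ spectrumOp A := not_not.2 ⟨T, hT⟩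
  have hcont : ContinuousOn (fun l : ℂ => z + l⁻¹) ((fun l : ℂ => z + l⁻¹) ⁻¹' spectrumOp A) := by
    refine continuousOn_const.add (continuousOn_id.inv₀ ?_)
    rintro l hl rfl
    exact hz (by simpa using hl)
  exact (hA.preimage hcont ((add_right_injective z).comp inv_injective)).mono
    fun l hl => hT.add_inv_mem_spectrumOp hl.2 hl.1

theorem isCompactOperator [CompleteSpace H] [IsStarNormal T] (hT : IsResolventAt A z T)
    (hA : essentialSpectrum A = ∅) : IsCompactOperator T := by
  refine isCompactOperator_of_isDiscrete_spectrum
    (hT.isDiscrete_spectrum (isDiscrete_spectrumOp hA)) fun l hl hl0 => ?_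
  have := (Set.sdiff_eq_empty.1 hA (hT.add_inv_mem_spectrumOp hl0 hl)).2.2.2
  exact hT.finiteDimensional_ker hl0

end IsResolventAt

end Resolvents

section NeumannResolvent

variable {Ω : Set (ℝ × ℝ)}

theorem inner_toLp_ofReal {ψ : ℝ × ℝ → ℝ} (hψ : MemLp (fun z => (ψ z : ℂ)) 2 (volume.restrict Ω))
    (u : L2 Ω) : inner ℂ hψ.toLp u = ∫ z in Ω, ψ z • u z := by
  rw [L2.inner_def]
  refine integral_congr_ae ?_
  filter_upwards [hψ.coeFn_toLp] with z hz
  rw [hz, RCLike.inner_apply, Complex.conj_ofReal, Complex.real_smul, mul_comm]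

theorem continuous_setIntegral_smul {ψ : ℝ × ℝ → ℝ} (hc : Continuous ψ) (hs : HasCompactSupport ψ) :
    Continuous fun u : L2 Ω => ∫ z in Ω, ψ z • u z := by
  simp only [← inner_toLp_ofReal (memLp_ofReal hc hs)]
  fun_prop

theorem isClosed_setOf_hasWeakPartial (e : ℝ × ℝ) :
    IsClosed {p : L2 Ω × L2 Ω | HasWeakPartial Ω e p.1 p.2} := by
  simp only [HasWeakPartial, Set.ofPred_forall]
  refine isClosed_iInter fun φ => isClosed_iInter fun hφ => isClosed_eq ?_ (Continuous.neg ?_)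
  · exact (continuous_setIntegral_smul (hφ.continuous_fderiv_apply e)
      (hφ.hasCompactSupport_fderiv_apply e)).comp continuous_fst
  · exact (continuous_setIntegral_smul hφ.contDiff.continuous hφ.hasCompactSupport).comp
      continuous_snd

instance completeSpace_H1 : CompleteSpace (H1 Ω) := by
  have hcont : ∀ i j, Continuous fun U : PiLp 2 fun _ : Fin 3 => L2 Ω => (U i, U j) := fun i j =>
    (PiLp.continuous_apply 2 _ i).prodMk (PiLp.continuous_apply 2 _ j)
  exact (((isClosed_setOf_hasWeakPartial (1, 0)).preimage (hcont 0 1)).inter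
    ((isClosed_setOf_hasWeakPartial (0, 1)).preimage (hcont 0 2))).completeSpace_coe

theorem inner_H1 (U V : H1 Ω) :
    inner ℂ V U = neumannForm Ω U V + inner ℂ (embedding Ω V) (embedding Ω U) := by
  change inner ℂ V.1 U.1 = _ + inner ℂ (V.1 0) (U.1 0)
  rw [PiLp.inner_apply, Fin.sum_univ_three, neumannForm]
  ring

theorem adjoint_embedding_eq_iff {f : L2 Ω} {U : H1 Ω} :
    (embedding Ω).adjoint f = U ↔
      ∀ V : H1 Ω, inner ℂ (embedding Ω V) (f - embedding Ω U) = neumannForm Ω U V := by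
  rw [ext_iff_inner_left ℂ]
  simp only [ContinuousLinearMap.adjoint_inner_right, inner_sub_right, inner_H1, sub_eq_iff_eq_add]

/-- The operator `J J*`, where `J` is the embedding of `H¹(Ω)` into `L²(Ω)`. For open `Ω` this is
the resolvent `(A_Ω + 1)⁻¹` of the Neumann Laplacian. -/
noncomputable def neumannResolvent (Ω : Set (ℝ × ℝ)) : L2 Ω →L[ℂ] L2 Ω :=
  embedding Ω ∘L (embedding Ω).adjoint

theorem isSelfAdjoint_neumannResolvent : IsSelfAdjoint (neumannResolvent Ω) := by
  have h := (embedding Ω).adjoint.isPositive_adjoint_comp_self.isSelfAdjoint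
  rwa [ContinuousLinearMap.adjoint_adjoint] at h

theorem isResolventAt_neumannResolvent (hΩ : IsOpen Ω) :
    IsResolventAt (neumannLaplacian Ω) ((-1 : ℝ) : ℂ) (neumannResolvent Ω) := by
  refine IsResolventAt.of_forall_mem_graph_iff fun u g => ?_
  rw [neumannLaplacian_graph hΩ, Complex.ofReal_neg, Complex.ofReal_one, neg_one_smul,
    sub_neg_eq_add]
  constructor
  · rintro ⟨U, rfl, hU⟩
    exact congrArg (embedding Ω) (adjoint_embedding_eq_iff.2 (by simpa using hU))
  · intro hu
    have hu' : embedding Ω ((embedding Ω).adjoint (g + u)) = u := hu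
    refine ⟨_, hu', ?_⟩
    simpa only [hu', add_sub_cancel_right] using
      adjoint_embedding_eq_iff.1 (Eq.refl ((embedding Ω).adjoint (g + u)))

theorem isSelfAdjoint_neumannLaplacian (hΩ : IsOpen Ω) : IsSelfAdjoint (neumannLaplacian Ω) :=
  (isResolventAt_neumannResolvent hΩ).isSelfAdjoint isSelfAdjoint_neumannResolvent

theorem essentialSpectrum_neumannLaplacian_nonempty (hΩ : IsOpen Ω)
    (hcomp : ¬ IsCompactOperator (embedding Ω)) :
    (essentialSpectrum (neumannLaplacian Ω)).Nonempty := by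
  have := isSelfAdjoint_neumannResolvent (Ω := Ω).isStarNormal
  by_contra hempty
  exact hcomp (isCompactOperator_of_comp_adjoint
    ((isResolventAt_neumannResolvent hΩ).isCompactOperator
      (Set.not_nonempty_iff_eq_empty.1 hempty)))

end NeumannResolvent

section SmoothFunctions

variable {Ω : Set (ℝ × ℝ)} {w : ℝ × ℝ → ℝ}

theorem IsTestFunction.setIntegral_fderiv_mul {ψ : ℝ × ℝ → ℝ} (hψ : IsTestFunction Ω ψ)
    (hw : ContDiff ℝ 1 w) (e : ℝ × ℝ) :
    ∫ z in Ω, fderiv ℝ ψ z e * w z = -∫ z in Ω, ψ z * fderiv ℝ w z e := by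
  have hψ0 : ∀ z ∉ Ω, ψ z = 0 := fun z hz =>
    image_eq_zero_of_notMem_tsupport fun h => hz (hψ.tsupport_subset h)
  have hdψ0 : ∀ z ∉ Ω, fderiv ℝ ψ z e = 0 := fun z hz => by
    rw [fderiv_of_notMem_tsupport ℝ fun h => hz (hψ.tsupport_subset h),
      zero_apply]
  rw [setIntegral_eq_integral_of_forall_compl_eq_zero fun z hz => by rw [hdψ0 z hz, zero_mul],
    setIntegral_eq_integral_of_forall_compl_eq_zero fun z hz => by rw [hψ0 z hz, zero_mul]]
  have hψc := hψ.contDiff.continuous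
  have hdw : Continuous fun z => fderiv ℝ w z e :=
    (hw.continuous_fderiv one_ne_zero).clm_apply continuous_const
  rw [integral_mul_fderiv_eq_neg_fderiv_mul_of_integrable (μ := volume) (f := ψ) (g := w) (v := e)
    (((hψ.continuous_fderiv_apply e).mul hw.continuous).integrable_of_hasCompactSupport
      (hψ.hasCompactSupport_fderiv_apply e).mul_right)
    ((hψc.mul hdw).integrable_of_hasCompactSupport hψ.hasCompactSupport.mul_right)
    ((hψc.mul hw.continuous).integrable_of_hasCompactSupport hψ.hasCompactSupport.mul_right)
    (fun z _ => hψ.contDiff.differentiable (by simp) z)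
    (fun z _ => hw.differentiable one_ne_zero z), neg_neg]

theorem setIntegral_smul_toLp_ofReal (hw : MemLp (fun z => (w z : ℂ)) 2 (volume.restrict Ω))
    (ψ : ℝ × ℝ → ℝ) :
    ∫ z in Ω, ψ z • hw.toLp (fun z => (w z : ℂ)) z = ((∫ z in Ω, ψ z * w z : ℝ) : ℂ) := by
  rw [← integral_complex_ofReal]
  refine integral_congr_ae ?_
  filter_upwards [hw.coeFn_toLp] with z hz
  rw [hz, Complex.real_smul, Complex.ofReal_mul]

theorem hasWeakPartial_of_contDiff (hw : ContDiff ℝ 1 w) (e : ℝ × ℝ)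
    (hLp : MemLp (fun z => (w z : ℂ)) 2 (volume.restrict Ω))
    (hLp' : MemLp (fun z => (fderiv ℝ w z e : ℂ)) 2 (volume.restrict Ω)) :
    HasWeakPartial Ω e hLp.toLp hLp'.toLp := by
  intro ψ hψ
  rw [setIntegral_smul_toLp_ofReal hLp, setIntegral_smul_toLp_ofReal hLp',
    hψ.setIntegral_fderiv_mul hw, Complex.ofReal_neg]

theorem norm_sq_toLp_ofReal (hw : MemLp (fun z => (w z : ℂ)) 2 (volume.restrict Ω)) :
    ‖hw.toLp‖ ^ 2 = ∫ z in Ω, w z ^ 2 := by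
  have h := inner_self_eq_norm_sq_to_K (𝕜 := ℂ) hw.toLp
  rw [inner_toLp_ofReal, setIntegral_smul_toLp_ofReal] at h
  simp only [← sq] at h
  exact (Complex.ofReal_injective (h.trans (Complex.ofReal_pow _ 2).symm)).symm

theorem memLp_ofReal_of_isBounded (hΩ : Bornology.IsBounded Ω) (hw : Continuous w) :
    MemLp (fun z => (w z : ℂ)) 2 (volume.restrict Ω) := by
  have hwc : Continuous fun z => (w z : ℂ) := Complex.continuous_ofReal.comp hw
  obtain ⟨C, hC⟩ := hΩ.isCompact_closure.exists_bound_of_continuousOn hwc.continuousOn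
  have : IsFiniteMeasure (volume.restrict Ω) :=
    isFiniteMeasure_restrict.2 hΩ.measure_lt_top.ne
  exact MemLp.of_bound hwc.aestronglyMeasurable C (ae_restrict_of_ae_restrict_of_subset
    subset_closure (ae_restrict_of_forall_mem measurableSet_closure hC))

theorem exists_H1_of_contDiff (hΩ : Bornology.IsBounded Ω) (hw : ContDiff ℝ 1 w) :
    ∃ U : H1 Ω, (embedding Ω U =ᵐ[volume.restrict Ω] fun z => (w z : ℂ)) ∧
      ‖embedding Ω U‖ ^ 2 = ∫ z in Ω, w z ^ 2 ∧
      ‖U‖ ^ 2 = ‖embedding Ω U‖ ^ 2 + (∫ z in Ω, fderiv ℝ w z (1, 0) ^ 2) +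
        ∫ z in Ω, fderiv ℝ w z (0, 1) ^ 2 := by
  have hLp := memLp_ofReal_of_isBounded hΩ hw.continuous
  have hLp' : ∀ e, MemLp (fun z => (fderiv ℝ w z e : ℂ)) 2 (volume.restrict Ω) := fun e =>
    memLp_ofReal_of_isBounded hΩ ((hw.continuous_fderiv one_ne_zero).clm_apply continuous_const)
  let U : H1 Ω := ⟨WithLp.toLp 2 ![hLp.toLp, (hLp' (1, 0)).toLp, (hLp' (0, 1)).toLp],
    hasWeakPartial_of_contDiff hw _ hLp (hLp' _), hasWeakPartial_of_contDiff hw _ hLp (hLp' _)⟩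
  refine ⟨U, hLp.coeFn_toLp, norm_sq_toLp_ofReal hLp, ?_⟩
  rw [← norm_sq_toLp_ofReal (hLp' _), ← norm_sq_toLp_ofReal (hLp' _)]
  change ‖U.1‖ ^ 2 = _
  rw [PiLp.norm_sq_eq_of_L2, Fin.sum_univ_three]
  rfl

theorem exists_H1_comp_fst (hΩ : Bornology.IsBounded Ω) {h : ℝ → ℝ} (hh : ContDiff ℝ 1 h) :
    ∃ U : H1 Ω, (embedding Ω U =ᵐ[volume.restrict Ω] fun z => (h z.1 : ℂ)) ∧
      ‖embedding Ω U‖ ^ 2 = ∫ z in Ω, h z.1 ^ 2 ∧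
      ‖U‖ ^ 2 = ‖embedding Ω U‖ ^ 2 + ∫ z in Ω, deriv h z.1 ^ 2 := by
  have hfderiv : ∀ z e : ℝ × ℝ, fderiv ℝ (fun z : ℝ × ℝ => h z.1) z e = deriv h z.1 * e.1 := by
    intro z e
    have hcomp := (hh.differentiable one_ne_zero z.1).hasDerivAt.comp_hasFDerivAt z
      (hasFDerivAt_fst (𝕜 := ℝ))
    exact congrArg (· e) hcomp.fderiv
  obtain ⟨U, hU, hUL2, hUH1⟩ := exists_H1_of_contDiff (w := fun z => h z.1) hΩ
    (hh.comp contDiff_fst)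
  refine ⟨U, hU, hUL2, hUH1.trans ?_⟩
  simp [hfderiv]

end SmoothFunctions

section Plateau

open Real

theorem deriv_smoothTransition_of_notMem_Icc {t : ℝ} (ht : t ∉ Set.Icc (0 : ℝ) 1) :
    deriv smoothTransition t = 0 := by
  rw [Set.mem_Icc, not_and_or, not_le, not_le] at ht
  rcases ht with ht | ht
  · have hzero : smoothTransition =ᶠ[nhds t] fun _ => 0 := by
      filter_upwards [eventually_lt_nhds ht] with s hs
      exact smoothTransition.zero_of_nonpos hs.le
    rw [hzero.deriv_eq, deriv_const]
  · have hone : smoothTransition =ᶠ[nhds t] fun _ => 1 := by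
      filter_upwards [eventually_gt_nhds ht] with s hs
      exact smoothTransition.one_of_one_le hs.le
    rw [hone.deriv_eq, deriv_const]

theorem exists_abs_deriv_smoothTransition_le : ∃ M, ∀ t, |deriv smoothTransition t| ≤ M :=
  (HasCompactSupport.intro isCompact_Icc
    fun _ => deriv_smoothTransition_of_notMem_Icc).exists_bound_of_continuous
    ((smoothTransition.contDiff (n := 1)).continuous_deriv le_rfl)

theorem sq_deriv_smoothTransition_div_le {M : ℝ} (hM : ∀ t, |deriv smoothTransition t| ≤ M)
    (t δ : ℝ) : (deriv smoothTransition t / δ) ^ 2 ≤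
      (Set.Icc (0 : ℝ) 1).indicator (fun _ => (M / δ) ^ 2) t := by
  refine Set.le_indicator_apply (fun _ => ?_) fun ht => ?_
  · rw [div_pow, div_pow, ← sq_abs (deriv _ _)]
    gcongr
    exact hM t
  · rw [deriv_smoothTransition_of_notMem_Icc ht, zero_div, sq, zero_mul]

/-- The smooth plateau function that rises from `0` to `1` on `[a, a + δ]`, stays equal to `1` on
`[a + δ, b - ε]`, and falls back to `0` on `[b - ε, b]`. -/
noncomputable def plateau (a b δ ε x : ℝ) : ℝ :=
  smoothTransition ((x - a) / δ) * smoothTransition ((b - x) / ε)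

variable {a b δ ε x : ℝ}

theorem contDiff_plateau {n : ℕ∞} : ContDiff ℝ n (plateau a b δ ε) :=
  (smoothTransition.contDiff.comp ((contDiff_id.sub contDiff_const).div_const δ)).mul
    (smoothTransition.contDiff.comp ((contDiff_const.sub contDiff_id).div_const ε))

theorem plateau_eq_one (hδ : 0 < δ) (hε : 0 < ε) (hax : a + δ ≤ x) (hxb : x ≤ b - ε) :
    plateau a b δ ε x = 1 := by
  rw [plateau, smoothTransition.one_of_one_le ((one_le_div hδ).2 (by linarith)),
    smoothTransition.one_of_one_le ((one_le_div hε).2 (by linarith)), one_mul]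

theorem plateau_eq_zero_of_le (hδ : 0 < δ) (hxa : x ≤ a) : plateau a b δ ε x = 0 := by
  rw [plateau, smoothTransition.zero_of_nonpos
    (div_nonpos_of_nonpos_of_nonneg (sub_nonpos.2 hxa) hδ.le), zero_mul]

theorem plateau_eq_zero_of_ge (hε : 0 < ε) (hbx : b ≤ x) : plateau a b δ ε x = 0 := by
  rw [plateau, smoothTransition.zero_of_nonpos (x := (b - x) / ε)
    (div_nonpos_of_nonpos_of_nonneg (sub_nonpos.2 hbx) hε.le), mul_zero]

theorem hasDerivAt_plateau : HasDerivAt (plateau a b δ ε)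
    (deriv smoothTransition ((x - a) / δ) / δ * smoothTransition ((b - x) / ε) -
      smoothTransition ((x - a) / δ) * (deriv smoothTransition ((b - x) / ε) / ε)) x := by
  have hderiv : ∀ t, HasDerivAt smoothTransition (deriv smoothTransition t) t := fun t =>
    ((smoothTransition.contDiff (n := 1)).differentiable one_ne_zero t).hasDerivAt
  have hrise := (hderiv ((x - a) / δ)).comp x (((hasDerivAt_id x).sub_const a).div_const δ)
  have hfall := (hderiv ((b - x) / ε)).comp x (((hasDerivAt_id x).const_sub b).div_const ε)
  refine (hrise.mul hfall).congr_deriv ?_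
  simp only [Function.comp_apply, id_eq]
  ring

theorem sub_div_mem_Icc_zero_one_iff (hδ : 0 < δ) :
    (x - a) / δ ∈ Set.Icc (0 : ℝ) 1 ↔ x ∈ Set.Icc a (a + δ) := by
  rw [Set.mem_Icc, Set.mem_Icc, div_le_one hδ, le_div_iff₀ hδ, zero_mul, sub_nonneg,
    sub_le_iff_le_add']

theorem sq_deriv_plateau_le (hδ : 0 < δ) (hε : 0 < ε) {M : ℝ}
    (hM : ∀ t, |deriv smoothTransition t| ≤ M) :
    deriv (plateau a b δ ε) x ^ 2 ≤
      2 * ((Set.Icc a (a + δ)).indicator (fun _ => (M / δ) ^ 2) x +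
        (Set.Icc (b - ε) b).indicator (fun _ => (M / ε) ^ 2) x) := by
  have hmul : ∀ p s : ℝ, 0 ≤ s → s ≤ 1 → (p * s) ^ 2 ≤ p ^ 2 := fun p s hs₀ hs₁ => by
    rw [mul_pow]
    exact mul_le_of_le_one_right (sq_nonneg p) (pow_le_one₀ hs₀ hs₁)
  rw [hasDerivAt_plateau.deriv, sub_eq_add_neg]
  refine add_sq_le.trans ?_
  rw [neg_sq, mul_comm (smoothTransition _)]
  gcongr
  · refine (hmul _ _ (smoothTransition.nonneg _) (smoothTransition.le_one _)).trans
      ((sq_deriv_smoothTransition_div_le hM _ _).trans_eq ?_)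
    simp only [Set.indicator, sub_div_mem_Icc_zero_one_iff hδ]
  · refine (hmul _ _ (smoothTransition.nonneg _) (smoothTransition.le_one _)).trans
      ((sq_deriv_smoothTransition_div_le hM _ _).trans_eq ?_)
    have hmem : (b - x) / ε ∈ Set.Icc (0 : ℝ) 1 ↔ x ∈ Set.Icc (b - ε) b := by
      rw [Set.mem_Icc, Set.mem_Icc, div_le_one hε, le_div_iff₀ hε, zero_mul, sub_nonneg,
        sub_le_comm, and_comm]
    simp only [Set.indicator, hmem]

end Plateau

section Geometry

variable {d dh β : ℕ → ℝ} {k : ℕ}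

theorem abscissa_succ (d dh : ℕ → ℝ) (k : ℕ) :
    abscissa d dh (k + 1) = abscissa d dh k + dh k + d (k + 1) := by
  simp only [abscissa, Finset.sum_range_succ _ (k + 1)]
  ring

theorem abscissa_sub_eq_sum (d dh : ℕ → ℝ) (k : ℕ) :
    abscissa d dh k - d k = ∑ j ∈ Finset.range k, (d j + dh j) := by
  simp only [abscissa, Finset.sum_range_succ]
  ring

theorem abscissa_add_eq_sum (d dh : ℕ → ℝ) (k : ℕ) :
    abscissa d dh k + dh k = ∑ j ∈ Finset.range (k + 1), (d j + dh j) :=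
  sub_add_cancel _ _

theorem room_subset_domain (d dh β : ℕ → ℝ) (k : ℕ) : room d dh k ⊆ domain d dh β :=
  Set.subset_iUnion_of_subset k Set.subset_union_left

theorem passage_subset_domain (d dh β : ℕ → ℝ) (k : ℕ) : passage d dh β k ⊆ domain d dh β :=
  Set.subset_iUnion_of_subset k Set.subset_union_right

theorem abscissa_add_le (hd : ∀ k, 0 < d k) (hdh : ∀ k, 0 < dh k) {j k : ℕ} (hjk : j < k) :
    abscissa d dh j + dh j ≤ abscissa d dh k - d k := by
  rw [abscissa_sub_eq_sum, abscissa_add_eq_sum]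
  exact Finset.sum_le_sum_of_subset_of_nonneg (Finset.range_subset_range.2 hjk)
    fun i _ _ => (add_pos (hd i) (hdh i)).le

theorem mem_passage_of_mem_domain (hd : ∀ k, 0 < d k) (hdh : ∀ k, 0 < dh k) {z : ℝ × ℝ}
    (hz : z ∈ domain d dh β) (hzk : z.1 ∈ Set.Icc (abscissa d dh k) (abscissa d dh k + dh k)) :
    z ∈ passage d dh β k := by
  obtain ⟨hkz, hzk⟩ := hzk
  obtain ⟨j, ⟨⟨hjz, hzj⟩, -⟩ | hpassage⟩ := Set.mem_iUnion.1 hz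
  · rcases lt_trichotomy k j with h | rfl | h
    · linarith [abscissa_add_le hd hdh h]
    · linarith
    · linarith [abscissa_add_le hd hdh h, hd k, hdh j]
  · have ⟨⟨hjz, hzj⟩, _⟩ := hpassage
    rcases lt_trichotomy k j with h | rfl | h
    · linarith [abscissa_add_le hd hdh h, hd j]
    · exact hpassage
    · linarith [abscissa_add_le hd hdh h, hd k]

/-- The passage with index `k`, prolonged into an open rectangle that crosses the two adjacent
rooms. Replacing the passages by these strips exhibits the domain as a union of open sets. -/
def strip (d dh β : ℕ → ℝ) (k : ℕ) : Set (ℝ × ℝ) :=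
  Set.Ioo (abscissa d dh k - d k) (abscissa d dh (k + 1)) ×ˢ Set.Ioo (-(β k / 2)) (β k / 2)

theorem passage_subset_strip (hd : ∀ k, 0 < d k) : passage d dh β k ⊆ strip d dh β k := by
  refine Set.prod_mono (Set.Icc_subset_Ioo (by linarith [hd k]) ?_) le_rfl
  linarith [abscissa_succ d dh k, hd (k + 1)]

theorem strip_subset_domain (hβd : ∀ k, β k ≤ min (d k) (d (k + 1))) :
    strip d dh β k ⊆ domain d dh β := by
  obtain ⟨hβk, hβk'⟩ := le_min_iff.1 (hβd k)
  rintro z ⟨⟨hleft, hright⟩, hbelow, habove⟩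
  rcases lt_or_ge z.1 (abscissa d dh k) with hroom | hroom
  · exact room_subset_domain d dh β k ⟨⟨hleft, hroom⟩, by linarith, by linarith⟩
  rcases le_or_gt z.1 (abscissa d dh k + dh k) with hpassage | hpassage
  · exact passage_subset_domain d dh β k ⟨⟨hroom, hpassage⟩, hbelow, habove⟩
  · refine room_subset_domain d dh β (k + 1) ⟨⟨?_, hright⟩, by linarith, by linarith⟩
    linarith [abscissa_succ d dh k]

theorem domain_eq_iUnion_strip (hd : ∀ k, 0 < d k) (hβd : ∀ k, β k ≤ min (d k) (d (k + 1))) :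
    domain d dh β = ⋃ k, room d dh k ∪ strip d dh β k :=
  Set.Subset.antisymm
    (Set.iUnion_mono fun _ => Set.union_subset_union_right _ (passage_subset_strip hd))
    (Set.iUnion_subset fun k =>
      Set.union_subset (room_subset_domain d dh β k) (strip_subset_domain hβd))

theorem measurableSet_passage : MeasurableSet (passage d dh β k) :=
  measurableSet_Icc.prod measurableSet_Ioo

theorem measurableSet_domain : MeasurableSet (domain d dh β) :=
  MeasurableSet.iUnion fun _ =>
    (measurableSet_Ioo.prod measurableSet_Ioo).union measurableSet_passage

theorem isOpen_domain (hd : ∀ k, 0 < d k) (hβd : ∀ k, β k ≤ min (d k) (d (k + 1))) :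
    IsOpen (domain d dh β) := by
  rw [domain_eq_iUnion_strip hd hβd]
  exact isOpen_iUnion fun k => (isOpen_Ioo.prod isOpen_Ioo).union (isOpen_Ioo.prod isOpen_Ioo)

theorem mk_zero_mem_room_iff (hd : ∀ k, 0 < d k) {x : ℝ} :
    (x, 0) ∈ room d dh k ↔ x ∈ Set.Ioo (abscissa d dh k - d k) (abscissa d dh k) := by
  simp [room, hd k]

theorem mk_zero_mem_strip_iff (hβ : ∀ k, 0 < β k) {x : ℝ} :
    (x, 0) ∈ strip d dh β k ↔ x ∈ Set.Ioo (abscissa d dh k - d k) (abscissa d dh (k + 1)) := by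
  simp [strip, hβ k]

theorem isConnected_room_union_strip (hd : ∀ k, 0 < d k) (hdh : ∀ k, 0 < dh k)
    (hβ : ∀ k, 0 < β k) : IsConnected (room d dh k ∪ strip d dh β k) := by
  have hroom : (abscissa d dh k - d k / 2, 0) ∈ room d dh k :=
    (mk_zero_mem_room_iff hd).2 ⟨by linarith [hd k], by linarith [hd k]⟩
  have hstrip : (abscissa d dh k - d k / 2, 0) ∈ strip d dh β k := by
    refine (mk_zero_mem_strip_iff hβ).2 ⟨by linarith [hd k], ?_⟩
    linarith [abscissa_succ d dh k, hd k, hdh k, hd (k + 1)]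
  exact IsConnected.union ⟨_, hroom, hstrip⟩
    ⟨⟨_, hroom⟩, ((convex_Ioo _ _).prod (convex_Ioo _ _)).isPreconnected⟩
    ⟨⟨_, hstrip⟩, ((convex_Ioo _ _).prod (convex_Ioo _ _)).isPreconnected⟩

theorem nonempty_strip_inter_room_succ (hd : ∀ k, 0 < d k) (hdh : ∀ k, 0 < dh k)
    (hβ : ∀ k, 0 < β k) : (strip d dh β k ∩ room d dh (k + 1)).Nonempty := by
  refine ⟨(abscissa d dh (k + 1) - d (k + 1) / 2, 0), (mk_zero_mem_strip_iff hβ).2 ⟨?_, ?_⟩,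
    (mk_zero_mem_room_iff hd).2 ⟨?_, ?_⟩⟩ <;>
  linarith [abscissa_succ d dh k, hd k, hdh k, hd (k + 1)]

theorem isConnected_domain (hd : ∀ k, 0 < d k) (hdh : ∀ k, 0 < dh k) (hβ : ∀ k, 0 < β k)
    (hβd : ∀ k, β k ≤ min (d k) (d (k + 1))) : IsConnected (domain d dh β) := by
  rw [domain_eq_iUnion_strip hd hβd]
  exact IsConnected.iUnion_of_chain (fun k => isConnected_room_union_strip hd hdh hβ)
    fun k => (nonempty_strip_inter_room_succ hd hdh hβ).mono
      (Set.inter_subset_inter Set.subset_union_right Set.subset_union_left)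

theorem isBounded_domain (hd : ∀ k, 0 < d k) (hdh : ∀ k, 0 < dh k)
    (hβd : ∀ k, β k ≤ d k) (hsum : Summable d) (hsum' : Summable dh) :
    Bornology.IsBounded (domain d dh β) := by
  set L := ∑' j, (d j + dh j)
  have hnonneg : ∀ j, 0 ≤ d j + dh j := fun j => (add_pos (hd j) (hdh j)).le
  have hright : ∀ k, abscissa d dh k + dh k ≤ L := fun k => by
    rw [abscissa_add_eq_sum]
    exact (hsum.add hsum').sum_le_tsum _ fun j _ => hnonneg j
  have hleft : ∀ k, 0 ≤ abscissa d dh k - d k := fun k => by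
    rw [abscissa_sub_eq_sum]
    exact Finset.sum_nonneg fun j _ => hnonneg j
  refine ((Metric.isBounded_Icc 0 L).prod (Metric.isBounded_Icc (-L) L)).subset
    (Set.iUnion_subset fun k => ?_)
  rintro z (⟨⟨_, _⟩, _, _⟩ | ⟨⟨_, _⟩, _, _⟩) <;> refine ⟨⟨?_, ?_⟩, ?_, ?_⟩ <;>
    linarith [hright k, hleft k, hd k, hdh k, hβd k]

theorem volume_real_prod_Ioo {s : Set ℝ} {r : ℝ} (hr : 0 ≤ r) :
    volume.real (s ×ˢ Set.Ioo (-(r / 2)) (r / 2)) = volume.real s * r := by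
  rw [Measure.volume_eq_prod, measureReal_prod_prod, Real.volume_real_Ioo_of_le (by linarith),
    sub_neg_eq_add, add_halves]

theorem volume_real_room (hd : ∀ k, 0 < d k) : volume.real (room d dh k) = d k ^ 2 := by
  rw [room, volume_real_prod_Ioo (hd k).le, Real.volume_real_Ioo_of_le (by linarith [hd k]),
    sub_sub_cancel, sq]

theorem volume_real_passage (hdh : ∀ k, 0 < dh k) (hβ : ∀ k, 0 < β k) :
    volume.real (passage d dh β k) = dh k * β k := by
  rw [passage, volume_real_prod_Ioo (hβ k).le, Real.volume_real_Icc_of_le (by linarith [hdh k]),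
    add_sub_cancel_left]

end Geometry

section RoomFunctions

variable {d dh β : ℕ → ℝ}

/-- The profile of a function that equals `1` on the room with index `k + 1` and descends to `0`
across the adjacent passages `k` and `k + 1`. -/
noncomputable def roomProfile (d dh : ℕ → ℝ) (k : ℕ) : ℝ → ℝ :=
  plateau (abscissa d dh k) (abscissa d dh (k + 1) + dh (k + 1)) (dh k) (dh (k + 1))

theorem contDiff_roomProfile {n : ℕ∞} (k : ℕ) : ContDiff ℝ n (roomProfile d dh k) :=
  contDiff_plateau

theorem roomProfile_eq_one (hdh : ∀ k, 0 < dh k) {k : ℕ} {x : ℝ}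
    (hx : x ∈ Set.Icc (abscissa d dh (k + 1) - d (k + 1)) (abscissa d dh (k + 1))) :
    roomProfile d dh k x = 1 :=
  plateau_eq_one (hdh k) (hdh (k + 1)) (by linarith [abscissa_succ d dh k, hx.1])
    (by linarith [hx.2])

theorem roomProfile_two_mul_mul_eq_zero (hd : ∀ k, 0 < d k) (hdh : ∀ k, 0 < dh k) {j k : ℕ}
    (hjk : j ≠ k) (x : ℝ) : roomProfile d dh (2 * j) x * roomProfile d dh (2 * k) x = 0 := by
  wlog hlt : j < k generalizing j k
  · rw [mul_comm]
    exact this hjk.symm (by lia)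
  have hle := abscissa_add_le hd hdh (show 2 * j + 1 < 2 * k by lia)
  rcases le_total x (abscissa d dh (2 * k)) with hx | hx
  · rw [roomProfile, roomProfile, plateau_eq_zero_of_le (hdh (2 * k)) hx, mul_zero]
  · rw [roomProfile, plateau_eq_zero_of_ge (hdh (2 * j + 1)) (by linarith [hd (2 * k)]), zero_mul]

theorem sq_le_setIntegral_roomProfile_sq (hd : ∀ k, 0 < d k) (hdh : ∀ k, 0 < dh k)
    (hΩ : Bornology.IsBounded (domain d dh β)) (k : ℕ) :
    d (k + 1) ^ 2 ≤ ∫ z in domain d dh β, roomProfile d dh k z.1 ^ 2 := by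
  have hcont : Continuous fun z : ℝ × ℝ => roomProfile d dh k z.1 ^ 2 :=
    ((contDiff_roomProfile (n := 0) k).continuous.comp continuous_fst).pow 2
  have hint : IntegrableOn (fun z : ℝ × ℝ => roomProfile d dh k z.1 ^ 2) (domain d dh β) :=
    (hcont.continuousOn.integrableOn_compact hΩ.isCompact_closure).mono_set subset_closure
  have hone : Set.EqOn (fun z : ℝ × ℝ => roomProfile d dh k z.1 ^ 2) 1 (room d dh (k + 1)) :=
    fun z hz => by
      simp only [roomProfile_eq_one hdh (Set.Ioo_subset_Icc_self hz.1), one_pow, Pi.one_apply]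
  calc d (k + 1) ^ 2 = ∫ _ in room d dh (k + 1), (1 : ℝ) := by
        rw [setIntegral_const, smul_eq_mul, mul_one, volume_real_room hd]
    _ = ∫ z in room d dh (k + 1), roomProfile d dh k z.1 ^ 2 :=
        (setIntegral_congr_fun (measurableSet_Ioo.prod measurableSet_Ioo) hone).symm
    _ ≤ ∫ z in domain d dh β, roomProfile d dh k z.1 ^ 2 :=
        setIntegral_mono_set hint (Filter.Eventually.of_forall fun _ => sq_nonneg _)
          (room_subset_domain d dh β (k + 1)).eventuallyLE

theorem sq_deriv_roomProfile_le (hd : ∀ k, 0 < d k) (hdh : ∀ k, 0 < dh k) {M : ℝ}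
    (hM : ∀ t, |deriv Real.smoothTransition t| ≤ M) (k : ℕ) {z : ℝ × ℝ}
    (hz : z ∈ domain d dh β) :
    deriv (roomProfile d dh k) z.1 ^ 2 ≤
      2 * ((passage d dh β k).indicator (fun _ => (M / dh k) ^ 2) z +
        (passage d dh β (k + 1)).indicator (fun _ => (M / dh (k + 1)) ^ 2) z) := by
  have hpassage : ∀ (j : ℕ) (c : ℝ), 0 ≤ c →
      (Set.Icc (abscissa d dh j) (abscissa d dh j + dh j)).indicator (fun _ => c) z.1 ≤
        (passage d dh β j).indicator (fun _ => c) z := fun j c hc =>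
    Set.indicator_apply_le' (fun hzj => by
      rw [Set.indicator_of_mem (mem_passage_of_mem_domain hd hdh hz hzj)])
      fun _ => Set.indicator_nonneg (fun _ _ => hc) z
  refine (sq_deriv_plateau_le (hdh k) (hdh (k + 1)) hM).trans ?_
  rw [add_sub_cancel_right]
  gcongr
  · exact hpassage k _ (sq_nonneg _)
  · exact hpassage (k + 1) _ (sq_nonneg _)

theorem setIntegral_sq_deriv_roomProfile_le (hd : ∀ k, 0 < d k) (hdh : ∀ k, 0 < dh k)
    (hβ : ∀ k, 0 < β k) (hΩ : Bornology.IsBounded (domain d dh β)) {M : ℝ}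
    (hM : ∀ t, |deriv Real.smoothTransition t| ≤ M) (k : ℕ) :
    ∫ z in domain d dh β, deriv (roomProfile d dh k) z.1 ^ 2 ≤
      2 * M ^ 2 * (β k / dh k + β (k + 1) / dh (k + 1)) := by
  have hint : ∀ j (c : ℝ), IntegrableOn ((passage d dh β j).indicator fun _ => c)
      (domain d dh β) := fun j c =>
    (integrableOn_const hΩ.measure_lt_top.ne).indicator measurableSet_passage
  have hval : ∀ j, ∫ z in domain d dh β,
      (passage d dh β j).indicator (fun _ => (M / dh j) ^ 2) z = M ^ 2 * (β j / dh j) := fun j => by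
    have hj := (hdh j).ne'
    rw [setIntegral_indicator measurableSet_passage,
      Set.inter_eq_right.2 (passage_subset_domain d dh β j), setIntegral_const,
      volume_real_passage hdh hβ, smul_eq_mul]
    field_simp
  calc ∫ z in domain d dh β, deriv (roomProfile d dh k) z.1 ^ 2
      ≤ ∫ z in domain d dh β, 2 * ((passage d dh β k).indicator (fun _ => (M / dh k) ^ 2) z +
          (passage d dh β (k + 1)).indicator (fun _ => (M / dh (k + 1)) ^ 2) z) :=
        integral_mono_of_nonneg (Filter.Eventually.of_forall fun _ => sq_nonneg _)
          (((hint _ _).add (hint _ _)).const_mul 2)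
          (ae_restrict_of_forall_mem measurableSet_domain fun _ =>
            sq_deriv_roomProfile_le hd hdh hM k)
    _ = 2 * M ^ 2 * (β k / dh k + β (k + 1) / dh (k + 1)) := by
        rw [integral_const_mul, integral_add (hint _ _) (hint _ _), hval, hval]
        ring

theorem inner_eq_zero_of_ae_eq_of_mul_eq_zero {Ω : Set (ℝ × ℝ)} {u v : L2 Ω} {f g : ℝ × ℝ → ℝ}
    (hu : u =ᵐ[volume.restrict Ω] fun z => (f z : ℂ))
    (hv : v =ᵐ[volume.restrict Ω] fun z => (g z : ℂ)) (hfg : ∀ z, f z * g z = 0) :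
    inner ℂ u v = 0 := by
  rw [L2.inner_def]
  refine integral_eq_zero_of_ae ?_
  filter_upwards [hu, hv] with z huz hvz
  rw [huz, hvz, RCLike.inner_apply, Complex.conj_ofReal, ← Complex.ofReal_mul, mul_comm, hfg,
    Complex.ofReal_zero, Pi.zero_apply]

theorem setIntegral_sq_deriv_roomProfile_le_mul_sq (hd : ∀ k, 0 < d k) (hdh : ∀ k, 0 < dh k)
    (hβ : ∀ k, 0 < β k) (hΩ : Bornology.IsBounded (domain d dh β)) {M : ℝ}
    (hM : ∀ t, |deriv Real.smoothTransition t| ≤ M) {C : ℝ} (hC : 0 ≤ C)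
    (hβC : ∀ k, β k ≤ C * dh k * min (d k) (d (k + 1)) ^ 2) (k : ℕ) :
    ∫ z in domain d dh β, deriv (roomProfile d dh k) z.1 ^ 2 ≤
      4 * M ^ 2 * C * d (k + 1) ^ 2 := by
  have hslope : ∀ (j : ℕ) {r : ℝ}, min (d j) (d (j + 1)) ≤ r → β j / dh j ≤ C * r ^ 2 :=
    fun j r hr => by
      have hmin : 0 ≤ min (d j) (d (j + 1)) := le_min (hd j).le (hd (j + 1)).le
      have hj := hdh j
      rw [div_le_iff₀ hj]
      calc β j ≤ C * dh j * min (d j) (d (j + 1)) ^ 2 := hβC j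
        _ ≤ C * dh j * r ^ 2 := by gcongr
        _ = C * r ^ 2 * dh j := by ring
  calc ∫ z in domain d dh β, deriv (roomProfile d dh k) z.1 ^ 2
      ≤ 2 * M ^ 2 * (β k / dh k + β (k + 1) / dh (k + 1)) :=
        setIntegral_sq_deriv_roomProfile_le hd hdh hβ hΩ hM k
    _ ≤ 2 * M ^ 2 * (C * d (k + 1) ^ 2 + C * d (k + 1) ^ 2) := by
        gcongr
        · exact hslope k (min_le_right _ _)
        · exact hslope (k + 1) (min_le_left _ _)
    _ = 4 * M ^ 2 * C * d (k + 1) ^ 2 := by ring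

theorem not_isCompactOperator_embedding_domain (hd : ∀ k, 0 < d k) (hdh : ∀ k, 0 < dh k)
    (hβ : ∀ k, 0 < β k) (hΩ : Bornology.IsBounded (domain d dh β)) {C : ℝ}
    (hβC : ∀ k, β k ≤ C * dh k * min (d k) (d (k + 1)) ^ 2) :
    ¬ IsCompactOperator (embedding (domain d dh β)) := by
  obtain ⟨M, hM⟩ := exists_abs_deriv_smoothTransition_le
  have hC : 0 ≤ C := by
    have hpos : 0 < C * (dh 0 * min (d 0) (d 1) ^ 2) := by
      linarith [hβ 0, hβC 0, mul_assoc C (dh 0) (min (d 0) (d 1) ^ 2)]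
    exact (pos_of_mul_pos_left hpos (mul_nonneg (hdh 0).le (sq_nonneg _))).le
  choose U hU hUL2 hUH1 using fun k =>
    exists_H1_comp_fst hΩ (contDiff_roomProfile (d := d) (dh := dh) (n := 1) (2 * k))
  have hlower : ∀ k, d (2 * k + 1) ^ 2 ≤ ‖embedding (domain d dh β) (U k)‖ ^ 2 := fun k =>
    (sq_le_setIntegral_roomProfile_sq hd hdh hΩ (2 * k)).trans_eq (hUL2 k).symm
  have hupper : ∀ k, ‖U k‖ ^ 2 ≤
      (1 + 4 * M ^ 2 * C) * ‖embedding (domain d dh β) (U k)‖ ^ 2 := fun k => by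
    have henergy := setIntegral_sq_deriv_roomProfile_le_mul_sq hd hdh hβ hΩ hM hC hβC (2 * k)
    have hscaled := mul_le_mul_of_nonneg_left (hlower k) (show 0 ≤ 4 * M ^ 2 * C by positivity)
    linarith [hUH1 k]
  refine not_isCompactOperator_of_pairwise_orthogonal (x := U) (C := √(1 + 4 * M ^ 2 * C))
    (fun k => ?_) (fun k => ?_) fun j k hjk => ?_
  · refine (Real.le_sqrt_of_sq_le (hupper k)).trans_eq ?_
    rw [Real.sqrt_mul (by positivity), Real.sqrt_sq (norm_nonneg _)]
  · have hpos := (sq_pos_of_pos (hd (2 * k + 1))).trans_le (hlower k)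
    exact norm_ne_zero_iff.1 (sq_pos_iff.1 hpos)
  · exact inner_eq_zero_of_ae_eq_of_mul_eq_zero (hU j) (hU k)
      (fun z => roomProfile_two_mul_mul_eq_zero hd hdh hjk z.1)

end RoomFunctions

section Parameters

theorem rpow_le_iSup_rpow_sub_mul_rpow {ι : Type*} {f : ι → ℝ} (hf : BddAbove (Set.range f))
    (hpos : ∀ k, 0 < f k) {s α : ℝ} (hs : s ≤ α) (k : ι) :
    f k ^ α ≤ (⨆ j, f j) ^ (α - s) * f k ^ s := by
  calc f k ^ α = f k ^ (α - s) * f k ^ s := by rw [← Real.rpow_add (hpos k), sub_add_cancel]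
    _ ≤ (⨆ j, f j) ^ (α - s) * f k ^ s := by
        have := (hpos k).le
        gcongr
        exact le_ciSup hf k

variable {d dh β : ℕ → ℝ} {C₁ C₂ α : ℝ}

theorem summable_of_le_mul_min (hsum : Summable d) (hdh : ∀ k, 0 < dh k) (hC₁ : 0 < C₁)
    (hdd : ∀ k, dh k ≤ C₁ * min (d k) (d (k + 1))) : Summable dh := by
  refine Summable.of_nonneg_of_le (fun k => (hdh k).le) (fun k => (hdd k).trans ?_)
    (hsum.mul_left C₁)
  gcongr
  exact min_le_left _ _

theorem le_min_of_le_mul_rpow (hdh : ∀ k, 0 < dh k) (hbdd : BddAbove (Set.range dh))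
    (hC₁ : 0 < C₁) (hdd : ∀ k, dh k ≤ C₁ * min (d k) (d (k + 1))) (hα : 1 ≤ α)
    (hβC : ∀ k, β k ≤ C₂ * dh k ^ α) (hC₂max : C₂ ≤ 1 / C₁ * (⨆ k, dh k) ^ (1 - α)) (k : ℕ) :
    β k ≤ min (d k) (d (k + 1)) := by
  have hsup : 0 < ⨆ j, dh j := (hdh k).trans_le (le_ciSup hbdd k)
  calc β k ≤ C₂ * dh k ^ α := hβC k
    _ ≤ 1 / C₁ * (⨆ j, dh j) ^ (1 - α) * ((⨆ j, dh j) ^ (α - 1) * dh k ^ (1 : ℝ)) := by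
        have := (hdh k).le
        gcongr
        exact rpow_le_iSup_rpow_sub_mul_rpow hbdd hdh hα k
    _ = dh k / C₁ := by
        rw [Real.rpow_one, mul_assoc, ← mul_assoc ((⨆ j, dh j) ^ (1 - α)), ← Real.rpow_add hsup,
          sub_add_sub_cancel, sub_self, Real.rpow_zero]
        ring
    _ ≤ min (d k) (d (k + 1)) := (div_le_iff₀' hC₁).2 (hdd k)

theorem le_mul_mul_sq_min_of_le_mul_rpow (hdh : ∀ k, 0 < dh k) (hbdd : BddAbove (Set.range dh))
    (hdd : ∀ k, dh k ≤ C₁ * min (d k) (d (k + 1))) (hα : 3 ≤ α) (hC₂ : 0 ≤ C₂)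
    (hβC : ∀ k, β k ≤ C₂ * dh k ^ α) (k : ℕ) :
    β k ≤ C₂ * (⨆ j, dh j) ^ (α - 3) * C₁ ^ 2 * dh k * min (d k) (d (k + 1)) ^ 2 := by
  have hk := hdh k
  have hsup : 0 < ⨆ j, dh j := hk.trans_le (le_ciSup hbdd k)
  calc β k ≤ C₂ * dh k ^ α := hβC k
    _ ≤ C₂ * ((⨆ j, dh j) ^ (α - 3) * dh k ^ (3 : ℝ)) := by
        gcongr
        exact rpow_le_iSup_rpow_sub_mul_rpow hbdd hdh hα k
    _ = C₂ * (⨆ j, dh j) ^ (α - 3) * dh k * dh k ^ 2 := by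
        rw [show (3 : ℝ) = (3 : ℕ) by norm_num, Real.rpow_natCast]
        ring
    _ ≤ C₂ * (⨆ j, dh j) ^ (α - 3) * dh k * (C₁ * min (d k) (d (k + 1))) ^ 2 := by
        gcongr
        exact hdd k
    _ = C₂ * (⨆ j, dh j) ^ (α - 3) * C₁ ^ 2 * dh k * min (d k) (d (k + 1)) ^ 2 := by ring

end Parameters

end RoomsPassages

theorem mainTheorem6_general {d dh β : ℕ → ℝ} {C : ℝ}
    (hd : ∀ k, 0 < d k) (hdh : ∀ k, 0 < dh k) (hβ : ∀ k, 0 < β k)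
    (hsum : Summable d) (hsum' : Summable dh) (hβd : ∀ k, β k ≤ min (d k) (d (k + 1)))
    (hβC : ∀ k, β k ≤ C * dh k * min (d k) (d (k + 1)) ^ 2) :
    IsOpen (RoomsPassages.domain d dh β) ∧
    IsConnected (RoomsPassages.domain d dh β) ∧
    Bornology.IsBounded (RoomsPassages.domain d dh β) ∧
    ¬ IsCompactOperator (RoomsPassages.embedding (RoomsPassages.domain d dh β)) ∧
    IsSelfAdjoint (RoomsPassages.neumannLaplacian (RoomsPassages.domain d dh β)) ∧
    (RoomsPassages.essentialSpectrum
      (RoomsPassages.neumannLaplacian (RoomsPassages.domain d dh β))).Nonempty := by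
  have hopen := RoomsPassages.isOpen_domain (dh := dh) hd hβd
  have hbdd := RoomsPassages.isBounded_domain hd hdh
    (fun k => (hβd k).trans (min_le_left _ _)) hsum hsum'
  have hcomp := RoomsPassages.not_isCompactOperator_embedding_domain hd hdh hβ hbdd hβC
  exact ⟨hopen, RoomsPassages.isConnected_domain hd hdh hβ hβd, hbdd, hcomp,
    RoomsPassages.isSelfAdjoint_neumannLaplacian hopen,
    RoomsPassages.essentialSpectrum_neumannLaplacian_nonempty hopen hcomp⟩

theorem mainTheorem6 (d dh β : ℕ → ℝ) (C₁ C₂ α : ℝ)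
    (hd : ∀ k, 0 < d k) (hdh : ∀ k, 0 < dh k) (hβ : ∀ k, 0 < β k)
    (hsum : Summable d)
    (hC₁ : 0 < C₁) (hdd : ∀ k, dh k ≤ C₁ * min (d k) (d (k + 1)))
    (hα : 3 ≤ α) (hC₂ : 0 < C₂) (hβC : ∀ k, β k ≤ C₂ * dh k ^ α)
    (hC₂max : C₂ ≤ 1 / C₁ * (⨆ k, dh k) ^ (1 - α)) :
    IsOpen (RoomsPassages.domain d dh β) ∧
    IsConnected (RoomsPassages.domain d dh β) ∧
    Bornology.IsBounded (RoomsPassages.domain d dh β) ∧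
    ¬ IsCompactOperator (RoomsPassages.embedding (RoomsPassages.domain d dh β)) ∧
    IsSelfAdjoint (RoomsPassages.neumannLaplacian (RoomsPassages.domain d dh β)) ∧
    (RoomsPassages.essentialSpectrum
      (RoomsPassages.neumannLaplacian (RoomsPassages.domain d dh β))).Nonempty := by
  have hsum' := RoomsPassages.summable_of_le_mul_min hsum hdh hC₁ hdd
  have hbdd := hsum'.tendsto_atTop_zero.bddAbove_range
  exact mainTheorem6_general hd hdh hβ hsum hsum'
    (RoomsPassages.le_min_of_le_mul_rpow hdh hbdd hC₁ hdd (by linarith) hβC hC₂max)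
    (RoomsPassages.le_mul_mul_sq_min_of_le_mul_rpow hdh hbdd hdd hα hC₂.le hβC)
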